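/- Let $0<\theta<\pi/2$ and $U(\theta)=\begin{bmatrix}\cos\theta&\sin\theta\\ \sin\theta&-\cos\theta\end{bmatrix}=P+Q$ with $P=\begin{bmatrix}\cos\theta&\sin\theta\\0&0\end{bmatrix}$, $Q=\begin{bmatrix}0&0\\ \sin\theta&-\cos\theta\end{bmatrix}$ (for $\theta=\pi/4$ this is the Hadamard walk), and let $\alpha,\beta\in\mathbb C$ with $|\alpha|^2+|\beta|^2=1$. Consider the quantum walk on $\mathbb Z$ started at the origin with the qubit $\varphi={}^T[\alpha,\beta]$: its amplitude at time $n=l+m$ and position $x=-l+m$ is $\Psi_n(x)={}^T[\Psi_n^L(x),\Psi_n^R(x)]=\Xi_n(l,m)\varphi$, where $\Xi_n(l,m)$ is the sum of all products of $n$ factors of which $l$ are $P$ and $m$ are $Q$; and $\Psi_n(x)=0$ at all other positions. Put $\|\Psi_n^L\|^2=\sum_{x=-n}^n|\Psi_n^L(x)|^2$, $\|\Psi_n^R\|^2=\sum_{x=-n}^n|\Psi_n^R(x)|^2$ and $\langle\Psi_n^R,\Psi_n^L\rangle=\sum_{x=-n}^n\overline{\Psi_n^R(x)}\,\Psi_n^L(x)$.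 Then, as $n\to\infty$, these three sequences converge, and their limits are $$\|\Psi_\infty^L\|^2=\Bigl(1-\frac{\sin\theta}{2}\Bigr)|\alpha|^2+\frac{\sin\theta}{2}|\beta|^2+\frac{\sin\theta(1-\sin\theta)}{2\cos\theta}\bigl(\alpha\overline\beta+\overline\alpha\beta\bigr),$$ $$\|\Psi_\infty^R\|^2=\frac{\sin\theta}{2}|\alpha|^2+\Bigl(1-\frac{\sin\theta}{2}\Bigr)|\beta|^2-\frac{\sin\theta(1-\sin\theta)}{2\cos\theta}\bigl(\alpha\overline\beta+\overline\alpha\beta\bigr),$$ $$\langle\Psi_\infty^R,\Psi_\infty^L\rangle=\frac{\sin\theta(1-\sin\theta)}{2\cos\theta}\Bigl\{|\alpha|^2-|\beta|^2+\frac{\sin\theta\,(\alpha\overline\beta+\overline\alpha\beta)+\alpha\overline\beta-\overline\alpha\beta}{\cos\theta}\Bigr\}.$$ Moreover, let $S_n^c=-\mathrm{Tr}\{\rho_n^c\log_2\rho_n^c\}$ be the von Neumann entropy of the reduced density operator $\rho_n^c$ of the coin, the partial trace of $|\Psi_n\rangle\langle\Psi_n|$ over the position. Then $$\lim_{n\to\infty}S_n^c=-\{r_+\log_2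 r_++r_-\log_2 r_-\},\qquad r_\pm=\frac{1\pm\sqrt{1-4\triangle}}{2},\qquad \triangle=\|\Psi_\infty^L\|^2\|\Psi_\infty^R\|^2-|\langle\Psi_\infty^R,\Psi_\infty^L\rangle|^2,$$ where $0\log_2 0=0$. -/

import Mathlib

open Filter Topology ComplexConjugate

noncomputable section

namespace QuantumWalk

/-- The coin `U(θ)`. The index `0` is the left chirality `L`, the index `1` the right one `R`. -/
def coin (θ : ℝ) : Matrix (Fin 2) (Fin 2) ℂ :=
  !![(Real.cos θ : ℂ), (Real.sin θ : ℂ); (Real.sin θ : ℂ), -(Real.cos θ : ℂ)]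

/-- The part `P` of the coin `U = P + Q` that moves the walker one step to the left. -/
def leftPart (U : Matrix (Fin 2) (Fin 2) ℂ) : Matrix (Fin 2) (Fin 2) ℂ :=
  !![U 0 0, U 0 1; 0, 0]

/-- The part `Q` of the coin `U = P + Q` that moves the walker one step to the right. -/
def rightPart (U : Matrix (Fin 2) (Fin 2) ℂ) : Matrix (Fin 2) (Fin 2) ℂ :=
  !![0, 0; U 1 0, U 1 1]

/-- `Ξ_n(l, m)`: the sum over all paths of `l` left and `m` right steps, that is, the sum of
`P ^ l₁ * Q ^ m₁ * ⋯ * P ^ lₙ * Q ^ mₙ` over all naturals with `lⱼ + mⱼ = 1`, `∑ lⱼ = l` and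
`∑ mⱼ = m`. -/
def pathSum (U : Matrix (Fin 2) (Fin 2) ℂ) (n l m : ℕ) : Matrix (Fin 2) (Fin 2) ℂ :=
  ∑ s ∈ (Fintype.piFinset fun _ : Fin n =>
      Finset.HasAntidiagonal.antidiagonal 1) with
      ∑ j, (s j).1 = l ∧ ∑ j, (s j).2 = m,
    (List.ofFn fun j => leftPart U ^ (s j).1 * rightPart U ^ (s j).2).prod

/-- The probability amplitude `Ψ_n(x) = Ξ_n(l, m) φ` of the walk started at the origin with the
qubit `φ`, where `n = l + m` and `x = -l + m`; it is zero if there are no such `l` and `m`. -/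
def amplitude (U : Matrix (Fin 2) (Fin 2) ℂ) (φ : Fin 2 → ℂ) (n : ℕ) (x : ℤ) : Fin 2 → ℂ :=
  ∑ p ∈ Finset.HasAntidiagonal.antidiagonal n with -(p.1 : ℤ) + (p.2 : ℤ) = x,
    (pathSum U n p.1 p.2).mulVec φ

/-- `‖Ψ_n^L‖²` for `i = 0`, and `‖Ψ_n^R‖²` for `i = 1`. -/
def normSqAmplitude (U : Matrix (Fin 2) (Fin 2) ℂ) (φ : Fin 2 → ℂ) (n : ℕ) (i : Fin 2) : ℝ :=
  ∑ x ∈ Finset.Icc (-(n : ℤ)) (n : ℤ), ‖amplitude U φ n x i‖ ^ 2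

/-- `⟨Ψ_n^R, Ψ_n^L⟩`, conjugate linear in the first argument. -/
def innerRL (U : Matrix (Fin 2) (Fin 2) ℂ) (φ : Fin 2 → ℂ) (n : ℕ) : ℂ :=
  ∑ x ∈ Finset.Icc (-(n : ℤ)) (n : ℤ), conj (amplitude U φ n x 1) * amplitude U φ n x 0

/-- The density operator `ρ_n = |Ψ_n⟩⟨Ψ_n|`, as a matrix indexed by position and chirality. -/
def density (U : Matrix (Fin 2) (Fin 2) ℂ) (φ : Fin 2 → ℂ) (n : ℕ) :
    Matrix (ℤ × Fin 2) (ℤ × Fin 2) ℂ :=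
  Matrix.of fun p q => amplitude U φ n p.1 p.2 * conj (amplitude U φ n q.1 q.2)

/-- The reduced density operator `ρ_n^c` of the coin: the partial trace of `ρ_n` over the position.
(All but finitely many terms of the sum vanish.) -/
def coinDensity (U : Matrix (Fin 2) (Fin 2) ℂ) (φ : Fin 2 → ℂ) (n : ℕ) :
    Matrix (Fin 2) (Fin 2) ℂ :=
  Matrix.of fun i j => ∑' x : ℤ, density U φ n (x, i) (x, j)

/-- The von Neumann entropy `-Tr (ρ log₂ ρ)` of a Hermitian matrix `ρ`, with `log₂ ρ` defined by
the functional calculus. (As `Real.logb 2 0 = 0`, the convention `0 log₂ 0 = 0` is built in.) -/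
def vonNeumannEntropy (ρ : Matrix (Fin 2) (Fin 2) ℂ) : ℝ :=
  -(Matrix.trace (ρ * cfc (Real.logb 2) ρ)).re

/-- The entropy of entanglement `S_n^c` between the coin and the position at time `n`. -/
def entanglementEntropy (U : Matrix (Fin 2) (Fin 2) ℂ) (φ : Fin 2 → ℂ) (n : ℕ) : ℝ :=
  vonNeumannEntropy (coinDensity U φ n)

end QuantumWalk

end

/-!
The Fourier transform in the position turns one step of the walk into multiplication by the matrix
`V(k) = exp(ik) P + exp(-ik) Q` (`sum_exp_smul_amplitude`, which rests on the expansion of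
`(a P + b Q) ^ n` over paths), so by Parseval's identity the coin density is the mean over `k` of
the rank-one matrices built from `V(k) ^ n φ` (`integral_mulVec_mul_conj`).

With `sin ω(k) = cos θ sin k`, one has `V = i sin ω + cos ω J` for a Hermitian involution `J(k)`.
The eigenvalues of `V` are therefore `exp(iω)` and `exp(i(π - ω))`, and the integrand splits into
the stationary part `(φ φ* + (J φ)(J φ)*) / 2` and two parts that oscillate with the phase
`± n (2ω - π)` (`momentumCoin_pow_mulVec_mul_conj`). As `0 < cos θ < 1`, the function `ω` is smooth
and its derivative vanishes only at `k = ± π/2` modulo `2π`. Substituting `ω` for `k` on the two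
arcs between these points, the Riemann–Lebesgue lemma shows that the oscillating parts tend to `0`
(`tendsto_integral_exp_pow_mul`). The entries of the stationary part reduce to the integrals of
`1 / D`, `cos² k / D` and `cos k sin k / D` with `D = 1 - cos² θ sin² k`; the first has the
primitive `arctan (sin θ tan k) / sin θ`, and the other two follow from it and from symmetry
(`integral_combination`).

Finally, the entropy of a `2 × 2` density matrix is a continuous function of its trace and
determinant, because these determine the eigenvalues (`vonNeumannEntropy_eq`). The trace tends to
`1` because the two limits of the diagonal entries add up to `‖α‖ ^ 2 + ‖β‖ ^ 2`.
-/

namespace QuantumWalk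

/-! ### The path sum as the coefficients of a power -/

/-- The noncommutative expansion of a power of a sum: every factor of the power chooses a
summand. -/
theorem sum_piFinset_prod_ofFn {R ι : Type*} [Semiring R] (S : Finset ι) (f : ι → R) (n : ℕ) :
    ∑ s ∈ Fintype.piFinset (fun _ : Fin n => S), (List.ofFn fun j => f (s j)).prod
      = (∑ i ∈ S, f i) ^ n := by
  induction n with
  | zero => simp
  | succ n ih =>
    rw [pow_succ', ← ih, Finset.sum_mul_sum, ← Finset.sum_product']
    refine Finset.sum_nbij' (fun s => (s 0, Fin.tail s))
      (fun p => (Fin.cons p.1 p.2 : Fin (n + 1) → ι)) ?_ ?_ ?_ ?_ ?_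
    · intro s hs
      simp only [Fintype.mem_piFinset, Finset.mem_product] at hs ⊢
      exact ⟨hs 0, fun j => hs j.succ⟩
    · rintro ⟨i, s⟩ hs
      simp only [Fintype.mem_piFinset, Finset.mem_product] at hs ⊢
      intro j
      refine Fin.cases ?_ (fun j => ?_) j
      · simpa using hs.1
      · simpa using hs.2 j
    · intro s _
      exact Fin.cons_self_tail s
    · rintro ⟨i, s⟩ _
      simp
    · intro s _
      simp [List.ofFn_succ, Fin.tail]

theorem prod_ofFn_smul_pow_mul {R : Type*} [Ring R] [Algebra ℂ R] (a b : ℂ) (P Q : R) :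
    ∀ (n : ℕ) (s : Fin n → ℕ × ℕ),
      (List.ofFn fun j => (a • P) ^ (s j).1 * (b • Q) ^ (s j).2).prod
        = (a ^ (∑ j, (s j).1) * b ^ (∑ j, (s j).2)) •
          (List.ofFn fun j => P ^ (s j).1 * Q ^ (s j).2).prod := by
  intro n
  induction n with
  | zero => simp
  | succ n ih =>
    intro s
    rw [List.ofFn_succ, List.ofFn_succ, List.prod_cons, List.prod_cons,
      ih fun j => s j.succ, Fin.sum_univ_succ, Fin.sum_univ_succ]
    simp only [smul_pow, smul_mul_assoc, mul_smul_comm, smul_smul]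
    congr 1
    ring

theorem sum_antidiagonal_smul_pathSum (U : Matrix (Fin 2) (Fin 2) ℂ) (a b : ℂ) (n : ℕ) :
    ∑ p ∈ Finset.HasAntidiagonal.antidiagonal n, (a ^ p.1 * b ^ p.2) • pathSum U n p.1 p.2
      = (a • leftPart U + b • rightPart U) ^ n := by
  have h := sum_piFinset_prod_ofFn (Finset.HasAntidiagonal.antidiagonal 1)
    (fun t : ℕ × ℕ => (a • leftPart U) ^ t.1 * (b • rightPart U) ^ t.2) n
  have h1 : ∑ t ∈ Finset.HasAntidiagonal.antidiagonal 1,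
      (a • leftPart U) ^ t.1 * (b • rightPart U) ^ t.2 = a • leftPart U + b • rightPart U := by
    rw [Finset.Nat.sum_antidiagonal_succ]
    simp [add_comm]
  rw [h1] at h
  rw [← h]
  -- Each path is sorted by its total numbers of left and right steps.
  rw [← Finset.sum_fiberwise_of_maps_to (g := fun s : Fin n → ℕ × ℕ => (∑ j, (s j).1, ∑ j, (s j).2))
    (t := Finset.HasAntidiagonal.antidiagonal n)]
  · refine Finset.sum_congr rfl fun p _ => ?_
    rw [pathSum, Finset.smul_sum]
    refine Finset.sum_congr ?_ fun s hs => ?_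
    · ext s
      simp [Prod.ext_iff]
    · simp only [Finset.mem_filter, Prod.ext_iff] at hs
      rw [prod_ofFn_smul_pow_mul, hs.2.1, hs.2.2]
  · intro s hs
    simp only [Fintype.mem_piFinset, Finset.HasAntidiagonal.mem_antidiagonal] at hs ⊢
    rw [← Finset.sum_add_distrib]
    simp [hs]

/-! ### The Fourier transform of the walk -/

/-- The one-step evolution matrix of the walk at wave number `k`. -/
noncomputable def momentumCoin (U : Matrix (Fin 2) (Fin 2) ℂ) (k : ℝ) : Matrix (Fin 2) (Fin 2) ℂ :=
  Complex.exp (k * Complex.I) • leftPart U + Complex.exp (-(k * Complex.I)) • rightPart U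

/-- The Fourier transform turns `n` steps of the walk into the `n`-th power of a matrix. -/
theorem sum_exp_smul_amplitude (U : Matrix (Fin 2) (Fin 2) ℂ) (φ : Fin 2 → ℂ) (n : ℕ) (k : ℝ) :
    ∑ x ∈ Finset.Icc (-(n : ℤ)) n, Complex.exp (-(k * Complex.I) * x) • amplitude U φ n x
      = (momentumCoin U k ^ n).mulVec φ := by
  rw [momentumCoin, ← sum_antidiagonal_smul_pathSum, Matrix.sum_mulVec,
    ← Finset.sum_fiberwise_of_maps_to (g := fun p : ℕ × ℕ => -(p.1 : ℤ) + (p.2 : ℤ))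
      (t := Finset.Icc (-(n : ℤ)) n)]
  · refine Finset.sum_congr rfl fun x _ => ?_
    rw [amplitude, Finset.smul_sum]
    refine Finset.sum_congr rfl fun p hp => ?_
    rw [Finset.mem_filter] at hp
    rw [Matrix.smul_mulVec, ← hp.2, ← Complex.exp_nat_mul, ← Complex.exp_nat_mul,
      ← Complex.exp_add]
    congr 2
    push_cast
    ring
  · intro p hp
    rw [Finset.HasAntidiagonal.mem_antidiagonal] at hp
    rw [Finset.mem_Icc]
    omega

theorem amplitude_eq_zero (U : Matrix (Fin 2) (Fin 2) ℂ) (φ : Fin 2 → ℂ) (n : ℕ) (x : ℤ)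
    (hx : x ∉ Finset.Icc (-(n : ℤ)) n) : amplitude U φ n x = 0 := by
  refine Finset.sum_eq_zero fun p hp => ?_
  rw [Finset.mem_filter, Finset.HasAntidiagonal.mem_antidiagonal] at hp
  rw [Finset.mem_Icc] at hx
  omega

theorem integral_exp_int_mul (a : ℝ) (m : ℤ) :
    ∫ k in a..a + 2 * Real.pi, Complex.exp ((m * Complex.I) * k)
      = if m = 0 then 2 * (Real.pi : ℂ) else 0 := by
  split_ifs with hm
  · simp [hm]
  · have hc : (m * Complex.I : ℂ) ≠ 0 := mul_ne_zero (by exact_mod_cast hm) Complex.I_ne_zero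
    rw [integral_exp_mul_complex hc]
    have : Complex.exp (m * Complex.I * ((a + 2 * Real.pi : ℝ) : ℂ))
        = Complex.exp (m * Complex.I * a) := by
      rw [Complex.exp_eq_exp_iff_exists_int]
      exact ⟨m, by push_cast; ring⟩
    rw [this, sub_self, zero_div]

/-- Parseval's identity for trigonometric polynomials. -/
theorem integral_sum_exp_mul_conj (S : Finset ℤ) (u v : ℤ → ℂ) (a : ℝ) :
    ∫ k in a..a + 2 * Real.pi, (∑ x ∈ S, Complex.exp (-(k * Complex.I) * x) * u x) *
        conj (∑ x ∈ S, Complex.exp (-(k * Complex.I) * x) * v x)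
      = 2 * Real.pi * ∑ x ∈ S, u x * conj (v x) := by
  have h : ∀ k : ℝ, (∑ x ∈ S, Complex.exp (-(k * Complex.I) * x) * u x) *
        conj (∑ x ∈ S, Complex.exp (-(k * Complex.I) * x) * v x)
      = ∑ x ∈ S, ∑ y ∈ S,
        (u x * conj (v y)) * Complex.exp ((((y - x : ℤ) : ℂ) * Complex.I) * k) := by
    intro k
    rw [map_sum, Finset.sum_mul_sum]
    refine Finset.sum_congr rfl fun x _ => Finset.sum_congr rfl fun y _ => ?_
    rw [map_mul, ← Complex.exp_conj]
    have : Complex.exp ((((y - x : ℤ) : ℂ) * Complex.I) * k)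
        = Complex.exp (-(k * Complex.I) * x) * Complex.exp (conj (-(k * Complex.I) * (y : ℂ))) := by
      rw [← Complex.exp_add]
      congr 1
      simp
      ring
    rw [this]
    ring
  simp_rw [h]
  rw [intervalIntegral.integral_finsetSum, Finset.mul_sum]
  · refine Finset.sum_congr rfl fun x hx => ?_
    rw [intervalIntegral.integral_finsetSum]
    · simp_rw [intervalIntegral.integral_const_mul, integral_exp_int_mul, sub_eq_zero]
      simp only [mul_ite, mul_zero, Finset.sum_ite_eq', hx, if_true]
      ring
    · intro y _
      exact Continuous.intervalIntegrable (by fun_prop) _ _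
  · intro x _
    exact Continuous.intervalIntegrable (by fun_prop) _ _

theorem integral_mulVec_mul_conj (U : Matrix (Fin 2) (Fin 2) ℂ) (φ : Fin 2 → ℂ) (n : ℕ)
    (a : ℝ) (i j : Fin 2) :
    ∫ k in a..a + 2 * Real.pi, (momentumCoin U k ^ n).mulVec φ i *
        conj ((momentumCoin U k ^ n).mulVec φ j)
      = 2 * Real.pi * ∑ x ∈ Finset.Icc (-(n : ℤ)) n,
        amplitude U φ n x i * conj (amplitude U φ n x j) := by
  rw [← integral_sum_exp_mul_conj (Finset.Icc (-(n : ℤ)) n) (fun x => amplitude U φ n x i)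
    (fun x => amplitude U φ n x j) a]
  simp_rw [← sum_exp_smul_amplitude, Finset.sum_apply, Pi.smul_apply, smul_eq_mul]

theorem coinDensity_apply (U : Matrix (Fin 2) (Fin 2) ℂ) (φ : Fin 2 → ℂ) (n : ℕ) (i j : Fin 2) :
    coinDensity U φ n i j = ∑ x ∈ Finset.Icc (-(n : ℤ)) n,
        amplitude U φ n x i * conj (amplitude U φ n x j) := by
  simp only [coinDensity, density, Matrix.of_apply]
  refine tsum_eq_sum fun x hx => ?_
  simp [amplitude_eq_zero U φ n x hx]

theorem normSqAmplitude_eq (U : Matrix (Fin 2) (Fin 2) ℂ) (φ : Fin 2 → ℂ) (n : ℕ) (i : Fin 2) :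
    (normSqAmplitude U φ n i : ℂ) = coinDensity U φ n i i := by
  rw [coinDensity_apply, normSqAmplitude]
  push_cast
  simp_rw [Complex.mul_conj']

theorem innerRL_eq (U : Matrix (Fin 2) (Fin 2) ℂ) (φ : Fin 2 → ℂ) (n : ℕ) :
    innerRL U φ n = coinDensity U φ n 0 1 := by
  rw [coinDensity_apply, innerRL]
  simp_rw [mul_comm]

/-! ### Oscillatory integrals without stationary points -/

/-- The Riemann–Lebesgue lemma with a phase `f` that has no stationary point inside the interval.
The substitution `y = f x` reduces it to the linear phase. The end points may be stationary, since
the Jacobian cancels the weight `1 / |f'|`. No integrability of `g` is assumed: without it, all the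
integrals are zero by convention. -/
theorem tendsto_integral_exp_pow_mul {a b : ℝ} (hab : a ≤ b) {f f' : ℝ → ℝ}
    (hf : ∀ x ∈ Set.Ioo a b, HasDerivAt f (f' x) x) (hf' : ∀ x ∈ Set.Ioo a b, f' x ≠ 0)
    (g : ℝ → ℂ) :
    Tendsto (fun n : ℕ => ∫ x in a..b, Complex.exp (f x * Complex.I) ^ n * g x) atTop (𝓝 0) := by
  -- By Rolle's theorem, `f` is injective.
  have hne : ∀ x ∈ Set.Ioo a b, ∀ y ∈ Set.Ioo a b, x < y → f x ≠ f y := by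
    intro x hx y hy hxy h
    have hsub : Set.Icc x y ⊆ Set.Ioo a b := fun z hz =>
      ⟨hx.1.trans_le hz.1, hz.2.trans_lt hy.2⟩
    obtain ⟨c, hc, hc0⟩ := exists_hasDerivAt_eq_zero hxy
      (fun z hz => (hf z (hsub hz)).continuousAt.continuousWithinAt) h
      (fun z hz => hf z (hsub (Set.Ioo_subset_Icc_self hz)))
    exact hf' c (hsub (Set.Ioo_subset_Icc_self hc)) hc0
  have hinj : Set.InjOn f (Set.Ioo a b) := by
    intro x hx y hy h
    rcases lt_trichotomy x y with hxy | hxy | hxy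
    · exact absurd h (hne x hx y hy hxy)
    · exact hxy
    · exact absurd h.symm (hne y hy x hx hxy)
  set t := Set.Ioo a b with ht
  set r := Function.invFunOn f t with hr
  have hrf : ∀ x ∈ t, r (f x) = x := fun x hx => hinj.leftInvOn_invFunOn hx
  have himg : MeasurableSet (f '' t) := MeasurableSet.image_of_continuousOn_injOn measurableSet_Ioo
    (fun x hx => (hf x hx).continuousAt.continuousWithinAt) hinj
  set G : ℝ → ℂ := (f '' t).indicator fun y => (|f' (r y)|⁻¹ : ℝ) • g (r y) with hG
  have key : ∀ n : ℕ, ∫ x in a..b, Complex.exp (f x * Complex.I) ^ n * g x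
      = ∫ y, Real.fourierChar (-(y * (-(n : ℝ) / (2 * Real.pi)))) • G y := by
    intro n
    have hchar : ∀ y : ℝ, (Real.fourierChar (-(y * (-(n : ℝ) / (2 * Real.pi)))) : ℂ)
        = Complex.exp (y * Complex.I) ^ n := by
      intro y
      rw [Real.fourierChar_apply, ← Complex.exp_nat_mul]
      congr 1
      have : 2 * Real.pi * -(y * (-(n : ℝ) / (2 * Real.pi))) = n * y := by
        field_simp
      rw [this]
      push_cast
      ring
    have hind : ∀ y : ℝ, Real.fourierChar (-(y * (-(n : ℝ) / (2 * Real.pi)))) • G y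
        = (f '' t).indicator (fun y => Complex.exp (y * Complex.I) ^ n *
            ((|f' (r y)|⁻¹ : ℝ) • g (r y))) y := by
      intro y
      rw [Circle.smul_def, hchar, hG, smul_eq_mul]
      by_cases hy : y ∈ f '' t <;> simp [hy]
    simp_rw [hind]
    rw [MeasureTheory.integral_indicator himg,
      MeasureTheory.integral_image_eq_integral_abs_deriv_smul measurableSet_Ioo
        (fun x hx => (hf x hx).hasDerivWithinAt) hinj,
      intervalIntegral.integral_of_le hab, MeasureTheory.integral_Ioc_eq_integral_Ioo]
    refine MeasureTheory.setIntegral_congr_fun measurableSet_Ioo fun x hx => ?_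
    have h0 : ((|f' x| : ℝ) : ℂ) ≠ 0 := by exact_mod_cast abs_ne_zero.2 (hf' x hx)
    simp only [hrf x hx, Complex.real_smul]
    push_cast
    field_simp
  simp_rw [key]
  refine (Real.tendsto_integral_exp_smul_cocompact G).comp ?_
  have : Tendsto (fun n : ℕ => -(n : ℝ) / (2 * Real.pi)) atTop atBot :=
    (tendsto_neg_atTop_atBot.comp tendsto_natCast_atTop_atTop).atBot_div_const (by positivity)
  exact this.mono_right atBot_le_cocompact

/-! ### The integrals of the stationary part -/

section Integrals

variable {θ : ℝ}

theorem one_sub_cos_mul_sin_sq_pos (hθ₀ : 0 < θ) (hθ₁ : θ < Real.pi / 2) (k : ℝ) :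
    0 < 1 - (Real.cos θ * Real.sin k) ^ 2 := by
  have hs : 0 < Real.sin θ := Real.sin_pos_of_pos_of_lt_pi hθ₀ (by linarith [Real.pi_pos])
  have h1 := Real.sin_sq_add_cos_sq θ
  have h2 : (Real.cos θ * Real.sin k) ^ 2 ≤ Real.cos θ ^ 2 := by
    rw [mul_pow]
    exact mul_le_of_le_one_right (sq_nonneg _) (Real.sin_sq_le_one k)
  nlinarith [pow_pos hs 2]

theorem continuous_inv_one_sub_cos_mul_sin_sq (hθ₀ : 0 < θ) (hθ₁ : θ < Real.pi / 2) :
    Continuous fun k => (1 - (Real.cos θ * Real.sin k) ^ 2)⁻¹ :=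
  Continuous.inv₀ (by fun_prop) fun k => (one_sub_cos_mul_sin_sq_pos hθ₀ hθ₁ k).ne'

/-- On a branch of the tangent, `arctan (sin θ * tan k) / sin θ` is a primitive. -/
theorem integral_inv_half_period (hθ₀ : 0 < θ) (hθ₁ : θ < Real.pi / 2) :
    ∫ k in -(Real.pi / 2)..Real.pi / 2, (1 - (Real.cos θ * Real.sin k) ^ 2)⁻¹
      = Real.pi / Real.sin θ := by
  have hs : 0 < Real.sin θ := Real.sin_pos_of_pos_of_lt_pi hθ₀ (by linarith [Real.pi_pos])
  rw [intervalIntegral.integral_eq_sub_of_hasDerivAt_of_tendsto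
    (f := fun k => Real.arctan (Real.sin θ * Real.tan k) / Real.sin θ)
    (fa := -(Real.pi / 2) / Real.sin θ) (fb := Real.pi / 2 / Real.sin θ)
    (by linarith [Real.pi_pos])]
  · ring
  · intro k hk
    have hc : 0 < Real.cos k := Real.cos_pos_of_mem_Ioo hk
    have hD := one_sub_cos_mul_sin_sq_pos hθ₀ hθ₁ k
    refine ((((Real.hasDerivAt_tan hc.ne').const_mul (Real.sin θ)).arctan).div_const
      (Real.sin θ)).congr_deriv ?_
    have h1 : 1 + (Real.sin θ * Real.tan k) ^ 2
        = (1 - (Real.cos θ * Real.sin k) ^ 2) / Real.cos k ^ 2 := by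
      rw [Real.tan_eq_sin_div_cos]
      field_simp
      rw [Real.cos_sq' θ, Real.cos_sq' k]
      ring
    rw [h1]
    field_simp
  · exact (continuous_inv_one_sub_cos_mul_sin_sq hθ₀ hθ₁).intervalIntegrable _ _
  · refine Tendsto.div_const ((Real.tendsto_arctan_atBot.mono_right nhdsWithin_le_nhds).comp ?_) _
    exact Tendsto.const_mul_atBot hs Real.tendsto_tan_neg_pi_div_two
  · refine Tendsto.div_const ((Real.tendsto_arctan_atTop.mono_right nhdsWithin_le_nhds).comp ?_) _
    exact Tendsto.const_mul_atTop hs Real.tendsto_tan_pi_div_two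

theorem integral_inv (hθ₀ : 0 < θ) (hθ₁ : θ < Real.pi / 2) :
    ∫ k in -(Real.pi / 2)..3 * Real.pi / 2, (1 - (Real.cos θ * Real.sin k) ^ 2)⁻¹
      = 2 * Real.pi / Real.sin θ := by
  have hi := fun a b => (continuous_inv_one_sub_cos_mul_sin_sq hθ₀ hθ₁).intervalIntegrable
    (μ := MeasureTheory.volume) a b
  rw [← intervalIntegral.integral_add_adjacent_intervals (hi _ (Real.pi / 2)) (hi _ _)]
  have h := intervalIntegral.integral_comp_add_right (a := -(Real.pi / 2)) (b := Real.pi / 2)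
    (fun k => (1 - (Real.cos θ * Real.sin k) ^ 2)⁻¹) Real.pi
  simp only [Real.sin_add_pi, mul_neg, neg_sq] at h
  rw [show -(Real.pi / 2) + Real.pi = Real.pi / 2 by ring,
    show Real.pi / 2 + Real.pi = 3 * Real.pi / 2 by ring] at h
  rw [← h, integral_inv_half_period hθ₀ hθ₁]
  ring

theorem integral_cos_sq_mul_inv (hθ₀ : 0 < θ) (hθ₁ : θ < Real.pi / 2) :
    ∫ k in -(Real.pi / 2)..3 * Real.pi / 2,
        Real.cos k ^ 2 * (1 - (Real.cos θ * Real.sin k) ^ 2)⁻¹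
      = 2 * Real.pi * (1 - Real.sin θ) / Real.cos θ ^ 2 := by
  have hs : 0 < Real.sin θ := Real.sin_pos_of_pos_of_lt_pi hθ₀ (by linarith [Real.pi_pos])
  have hc : 0 < Real.cos θ := Real.cos_pos_of_mem_Ioo ⟨by linarith [Real.pi_pos], hθ₁⟩
  have h : ∀ k, Real.cos k ^ 2 * (1 - (Real.cos θ * Real.sin k) ^ 2)⁻¹
      = (Real.cos θ ^ 2)⁻¹ - Real.sin θ ^ 2 / Real.cos θ ^ 2 *
        (1 - (Real.cos θ * Real.sin k) ^ 2)⁻¹ := by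
    intro k
    have hD := (one_sub_cos_mul_sin_sq_pos hθ₀ hθ₁ k).ne'
    rw [mul_pow] at hD ⊢
    field_simp
    rw [Real.cos_sq' k, Real.sin_sq θ]
    ring
  simp_rw [h]
  rw [intervalIntegral.integral_sub (by simp)
    (((continuous_inv_one_sub_cos_mul_sin_sq hθ₀ hθ₁).const_mul _).intervalIntegrable _ _),
    intervalIntegral.integral_const_mul, integral_inv hθ₀ hθ₁, intervalIntegral.integral_const,
    smul_eq_mul]
  field_simp
  ring

/-- The reflection `k ↦ π - k` preserves the interval and changes the sign of the integrand. -/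
theorem integral_cos_mul_sin_mul_inv (θ : ℝ) :
    ∫ k in -(Real.pi / 2)..3 * Real.pi / 2,
        Real.cos k * Real.sin k * (1 - (Real.cos θ * Real.sin k) ^ 2)⁻¹ = 0 := by
  have h := intervalIntegral.integral_comp_sub_left (a := -(Real.pi / 2)) (b := 3 * Real.pi / 2)
    (fun k => Real.cos k * Real.sin k * (1 - (Real.cos θ * Real.sin k) ^ 2)⁻¹) Real.pi
  simp only [Real.sin_pi_sub, Real.cos_pi_sub, neg_mul, intervalIntegral.integral_neg] at h
  rw [show Real.pi - 3 * Real.pi / 2 = -(Real.pi / 2) by ring,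
    show Real.pi - -(Real.pi / 2) = 3 * Real.pi / 2 by ring] at h
  linarith

/-- The three real integrals combined with complex coefficients. -/
theorem integral_combination (hθ₀ : 0 < θ) (hθ₁ : θ < Real.pi / 2) (A B C : ℂ) :
    ∫ k in -(Real.pi / 2)..3 * Real.pi / 2,
        (A + B * (Real.cos k : ℂ) ^ 2 + C * ((Real.cos k : ℂ) * (Real.sin k : ℂ))) *
          (1 - ((Real.cos θ : ℂ) * (Real.sin k : ℂ)) ^ 2)⁻¹
      = 2 * Real.pi * (A / Real.sin θ + B * (1 - Real.sin θ) / Real.cos θ ^ 2) := by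
  have hcont := continuous_inv_one_sub_cos_mul_sin_sq hθ₀ hθ₁
  have h : ∀ k : ℝ,
      (A + B * (Real.cos k : ℂ) ^ 2 + C * ((Real.cos k : ℂ) * (Real.sin k : ℂ))) *
          (1 - ((Real.cos θ : ℂ) * (Real.sin k : ℂ)) ^ 2)⁻¹
        = (A * (((1 - (Real.cos θ * Real.sin k) ^ 2)⁻¹ : ℝ) : ℂ)
          + B * ((Real.cos k ^ 2 * (1 - (Real.cos θ * Real.sin k) ^ 2)⁻¹ : ℝ) : ℂ))
          + C * ((Real.cos k * Real.sin k * (1 - (Real.cos θ * Real.sin k) ^ 2)⁻¹ : ℝ) : ℂ) := by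
    intro k
    push_cast
    ring
  simp_rw [h]
  rw [intervalIntegral.integral_add, intervalIntegral.integral_add]
  · simp_rw [intervalIntegral.integral_const_mul]
    rw [intervalIntegral.integral_ofReal, intervalIntegral.integral_ofReal,
      intervalIntegral.integral_ofReal, integral_inv hθ₀ hθ₁, integral_cos_sq_mul_inv hθ₀ hθ₁,
      integral_cos_mul_sin_mul_inv]
    push_cast
    ring
  all_goals exact Continuous.intervalIntegrable (by fun_prop) _ _

end Integrals

/-! ### Spectral decomposition of the one-step matrix -/

/-- If `J` is an involution, then `x + y * J` has the eigenvalues `a = x + y` and `b = x - y`, and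
its powers are read off from those of `a` and `b`. -/
theorem pow_of_involution {R : Type*} [Ring R] [Algebra ℂ R] {J : R} (hJ : J * J = 1) (a b : ℂ)
    (n : ℕ) :
    (((a + b) / 2) • (1 : R) + ((a - b) / 2) • J) ^ n
      = ((a ^ n + b ^ n) / 2) • (1 : R) + ((a ^ n - b ^ n) / 2) • J := by
  induction n with
  | zero => simp
  | succ n ih =>
    rw [pow_succ, ih]
    simp only [add_mul, mul_add, smul_mul_assoc, mul_smul_comm, mul_one, one_mul, hJ]
    module

/-- The eigenvalues of the one-step matrix at wave number `k` are `exp (i ω)` and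
`exp (i (π - ω))`, where `ω` is this dispersion relation. -/
noncomputable def dispersion (θ k : ℝ) : ℝ := Real.arcsin (Real.cos θ * Real.sin k)

/-- The Hermitian traceless part of the one-step matrix at wave number `k`. -/
noncomputable def hermitianPart (θ k : ℝ) : Matrix (Fin 2) (Fin 2) ℂ :=
  !![(Real.cos θ * Real.cos k : ℂ), Real.sin θ * (Real.cos k + Real.sin k * Complex.I);
    Real.sin θ * (Real.cos k - Real.sin k * Complex.I), -(Real.cos θ * Real.cos k : ℂ)]

/-- The Hermitian involution with the same eigenvectors as the one-step matrix at wave number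
`k`. -/
noncomputable def involution (θ k : ℝ) : Matrix (Fin 2) (Fin 2) ℂ :=
  ((Real.cos (dispersion θ k) : ℂ)⁻¹) • hermitianPart θ k

section Spectral

variable {θ : ℝ}

theorem abs_cos_mul_sin_lt_one (hθ₀ : 0 < θ) (hθ₁ : θ < Real.pi / 2) (k : ℝ) :
    |Real.cos θ * Real.sin k| < 1 := by
  rw [← sq_lt_one_iff_abs_lt_one]
  linarith [one_sub_cos_mul_sin_sq_pos hθ₀ hθ₁ k]

theorem sin_dispersion (hθ₀ : 0 < θ) (hθ₁ : θ < Real.pi / 2) (k : ℝ) :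
    Real.sin (dispersion θ k) = Real.cos θ * Real.sin k := by
  have h := abs_lt.1 (abs_cos_mul_sin_lt_one hθ₀ hθ₁ k)
  exact Real.sin_arcsin h.1.le h.2.le

theorem cos_dispersion (θ k : ℝ) :
    Real.cos (dispersion θ k) = √(1 - (Real.cos θ * Real.sin k) ^ 2) :=
  Real.cos_arcsin _

theorem cos_dispersion_pos (hθ₀ : 0 < θ) (hθ₁ : θ < Real.pi / 2) (k : ℝ) :
    0 < Real.cos (dispersion θ k) := by
  rw [cos_dispersion]
  exact Real.sqrt_pos.2 (one_sub_cos_mul_sin_sq_pos hθ₀ hθ₁ k)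

theorem cos_dispersion_sq (hθ₀ : 0 < θ) (hθ₁ : θ < Real.pi / 2) (k : ℝ) :
    Real.cos (dispersion θ k) ^ 2 = 1 - (Real.cos θ * Real.sin k) ^ 2 := by
  rw [cos_dispersion, Real.sq_sqrt (one_sub_cos_mul_sin_sq_pos hθ₀ hθ₁ k).le]

theorem hasDerivAt_dispersion (hθ₀ : 0 < θ) (hθ₁ : θ < Real.pi / 2) (k : ℝ) :
    HasDerivAt (dispersion θ)
      (1 / √(1 - (Real.cos θ * Real.sin k) ^ 2) * (Real.cos θ * Real.cos k)) k := by
  have h := abs_lt.1 (abs_cos_mul_sin_lt_one hθ₀ hθ₁ k)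
  exact (Real.hasDerivAt_arcsin h.1.ne' h.2.ne).comp k
    ((Real.hasDerivAt_sin k).const_mul (Real.cos θ))

@[fun_prop]
theorem continuous_dispersion (θ : ℝ) : Continuous (dispersion θ) :=
  Real.continuous_arcsin.comp (by fun_prop)

theorem hermitianPart_mul_self (hθ₀ : 0 < θ) (hθ₁ : θ < Real.pi / 2) (k : ℝ) :
    hermitianPart θ k * hermitianPart θ k
      = ((Real.cos (dispersion θ k) : ℂ) ^ 2) • (1 : Matrix (Fin 2) (Fin 2) ℂ) := by
  have hθ : (Real.sin θ : ℂ) ^ 2 = 1 - (Real.cos θ : ℂ) ^ 2 := by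
    exact_mod_cast Real.sin_sq θ
  have hk : (Real.cos k : ℂ) ^ 2 = 1 - (Real.sin k : ℂ) ^ 2 := by
    exact_mod_cast Real.cos_sq' k
  have hD : (Real.cos (dispersion θ k) : ℂ) ^ 2
      = 1 - ((Real.cos θ : ℂ) * (Real.sin k : ℂ)) ^ 2 := by
    exact_mod_cast cos_dispersion_sq hθ₀ hθ₁ k
  rw [hD, hermitianPart, Matrix.mul_fin_two, Matrix.one_fin_two]
  generalize (Real.sin θ : ℂ) = s at *
  generalize (Real.cos θ : ℂ) = c at *
  generalize (Real.sin k : ℂ) = y at *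
  generalize (Real.cos k : ℂ) = x at *
  have hI := Complex.I_sq
  ext i j
  fin_cases i <;> fin_cases j <;> simp
  · linear_combination (x ^ 2 + y ^ 2) * hθ + hk - s ^ 2 * y ^ 2 * hI
  · ring
  · ring
  · linear_combination (x ^ 2 + y ^ 2) * hθ + hk - s ^ 2 * y ^ 2 * hI

theorem involution_mul_self (hθ₀ : 0 < θ) (hθ₁ : θ < Real.pi / 2) (k : ℝ) :
    involution θ k * involution θ k = 1 := by
  have h : (Real.cos (dispersion θ k) : ℂ) ≠ 0 := by
    exact_mod_cast (cos_dispersion_pos hθ₀ hθ₁ k).ne'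
  rw [involution, smul_mul_smul_comm, hermitianPart_mul_self hθ₀ hθ₁, smul_smul]
  have : (Real.cos (dispersion θ k) : ℂ)⁻¹ * (Real.cos (dispersion θ k) : ℂ)⁻¹
      * (Real.cos (dispersion θ k) : ℂ) ^ 2 = 1 := by
    field_simp
  rw [this, one_smul]

theorem momentumCoin_eq (hθ₀ : 0 < θ) (hθ₁ : θ < Real.pi / 2) (k : ℝ) :
    momentumCoin (coin θ) k
      = ((Complex.exp (dispersion θ k * Complex.I)
          + Complex.exp ((Real.pi - dispersion θ k : ℝ) * Complex.I)) / 2) • 1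
        + ((Complex.exp (dispersion θ k * Complex.I)
          - Complex.exp ((Real.pi - dispersion θ k : ℝ) * Complex.I)) / 2) • involution θ k := by
  have h : (Real.cos (dispersion θ k) : ℂ) ≠ 0 := by
    exact_mod_cast (cos_dispersion_pos hθ₀ hθ₁ k).ne'
  have hs : (Real.sin (dispersion θ k) : ℂ) = Real.cos θ * Real.sin k := by
    exact_mod_cast sin_dispersion hθ₀ hθ₁ k
  simp only [Complex.exp_mul_I, ← Complex.ofReal_cos, ← Complex.ofReal_sin, Real.cos_pi_sub,
    Real.sin_pi_sub, momentumCoin, involution, smul_smul, ← neg_mul, ← Complex.ofReal_neg,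
    Real.cos_neg, Real.sin_neg]
  rw [hs, Matrix.one_fin_two, hermitianPart, leftPart, rightPart, coin]
  have h1 : ((Real.cos (dispersion θ k) : ℂ) + Real.cos θ * Real.sin k * Complex.I
      - ((-Real.cos (dispersion θ k) : ℝ) + Real.cos θ * Real.sin k * Complex.I)) / 2
      * (Real.cos (dispersion θ k) : ℂ)⁻¹ = 1 := by
    push_cast
    push_cast at h
    field_simp
    ring
  have h2 : ((Real.cos (dispersion θ k) : ℂ) + Real.cos θ * Real.sin k * Complex.I
      + ((-Real.cos (dispersion θ k) : ℝ) + Real.cos θ * Real.sin k * Complex.I)) / 2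
      = Real.cos θ * Real.sin k * Complex.I := by
    push_cast
    ring
  rw [h1, h2]
  ext i j
  fin_cases i <;> fin_cases j <;> simp <;> ring

@[fun_prop]
theorem continuous_involution_mulVec (hθ₀ : 0 < θ) (hθ₁ : θ < Real.pi / 2) (φ : Fin 2 → ℂ)
    (i : Fin 2) : Continuous fun k => (involution θ k).mulVec φ i := by
  simp only [involution, Matrix.smul_mulVec, Pi.smul_apply, smul_eq_mul]
  refine Continuous.mul (Continuous.inv₀ (by fun_prop) fun k => ?_) ?_
  · exact_mod_cast (cos_dispersion_pos hθ₀ hθ₁ k).ne'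
  · fin_cases i <;> simp [hermitianPart, Matrix.mulVec, dotProduct, Fin.sum_univ_two] <;> fun_prop

/-- The integrand of Parseval's identity: a part that does not depend on `n`, and two parts that
oscillate with the difference of the phases of the eigenvalues. -/
theorem momentumCoin_pow_mulVec_mul_conj (hθ₀ : 0 < θ) (hθ₁ : θ < Real.pi / 2) (k : ℝ)
    (φ : Fin 2 → ℂ) (n : ℕ) (i j : Fin 2) :
    (momentumCoin (coin θ) k ^ n).mulVec φ i * conj ((momentumCoin (coin θ) k ^ n).mulVec φ j)
      = (φ i * conj (φ j) + (involution θ k).mulVec φ i * conj ((involution θ k).mulVec φ j)) / 2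
        + (Complex.exp ((2 * dispersion θ k - Real.pi : ℝ) * Complex.I) ^ n
            * ((φ i + (involution θ k).mulVec φ i)
              * (conj (φ j) - conj ((involution θ k).mulVec φ j)) / 4)
          + Complex.exp ((Real.pi - 2 * dispersion θ k : ℝ) * Complex.I) ^ n
            * ((φ i - (involution θ k).mulVec φ i)
              * (conj (φ j) + conj ((involution θ k).mulVec φ j)) / 4)) := by
  rw [momentumCoin_eq hθ₀ hθ₁, pow_of_involution (involution_mul_self hθ₀ hθ₁ k)]
  simp only [Matrix.add_mulVec, Matrix.smul_mulVec, Matrix.one_mulVec, Pi.add_apply,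
    Pi.smul_apply, smul_eq_mul, map_add, map_mul, map_div₀, map_sub, map_pow, ← Complex.exp_conj,
    Complex.conj_I, Complex.conj_ofReal, map_ofNat]
  generalize (involution θ k).mulVec φ i = q
  generalize conj ((involution θ k).mulVec φ j) = q'
  generalize conj (φ j) = p'
  generalize φ i = p
  have h1 : Complex.exp (dispersion θ k * Complex.I) ^ n
      * Complex.exp (dispersion θ k * -Complex.I) ^ n = 1 := by
    rw [← mul_pow, ← Complex.exp_add, mul_neg, add_neg_cancel, Complex.exp_zero, one_pow]
  have h2 : Complex.exp ((Real.pi - dispersion θ k : ℝ) * Complex.I) ^ n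
      * Complex.exp ((Real.pi - dispersion θ k : ℝ) * -Complex.I) ^ n = 1 := by
    rw [← mul_pow, ← Complex.exp_add, mul_neg, add_neg_cancel, Complex.exp_zero, one_pow]
  have h3 : Complex.exp ((2 * dispersion θ k - Real.pi : ℝ) * Complex.I) ^ n
      = Complex.exp (dispersion θ k * Complex.I) ^ n
        * Complex.exp ((Real.pi - dispersion θ k : ℝ) * -Complex.I) ^ n := by
    rw [← mul_pow, ← Complex.exp_add]
    congr 2
    push_cast
    ring
  have h4 : Complex.exp ((Real.pi - 2 * dispersion θ k : ℝ) * Complex.I) ^ n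
      = Complex.exp ((Real.pi - dispersion θ k : ℝ) * Complex.I) ^ n
        * Complex.exp (dispersion θ k * -Complex.I) ^ n := by
    rw [← mul_pow, ← Complex.exp_add]
    congr 2
    push_cast
    ring
  rw [h3, h4]
  linear_combination ((p + q) * (p' + q') / 4) * h1 + ((p - q) * (p' - q') / 4) * h2

/-! ### The limit of the coin density -/

/-- The derivative of the dispersion relation `ω` vanishes only at `k = ±π/2` modulo `2π`. Hence
integrals that oscillate with a phase `f` such that `f' = ε * ω'` tend to zero. -/
theorem tendsto_integral_oscillating (hθ₀ : 0 < θ) (hθ₁ : θ < Real.pi / 2) {f : ℝ → ℝ} {ε : ℝ}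
    (hε : ε ≠ 0) (hf : ∀ k, HasDerivAt f
      (ε * (1 / √(1 - (Real.cos θ * Real.sin k) ^ 2) * (Real.cos θ * Real.cos k))) k)
    {g : ℝ → ℂ} (hg : Continuous g) :
    Tendsto (fun n : ℕ => ∫ k in -(Real.pi / 2)..3 * Real.pi / 2,
      Complex.exp (f k * Complex.I) ^ n * g k) atTop (𝓝 0) := by
  have hfc : Continuous f := continuous_iff_continuousAt.2 fun k => (hf k).continuousAt
  have hi : ∀ (n : ℕ) (a b : ℝ), IntervalIntegrable
      (fun k => Complex.exp (f k * Complex.I) ^ n * g k) MeasureTheory.volume a b :=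
    fun n a b => Continuous.intervalIntegrable (by fun_prop) _ _
  have hc : 0 < Real.cos θ := Real.cos_pos_of_mem_Ioo ⟨by linarith [Real.pi_pos], hθ₁⟩
  have hne : ∀ k, Real.cos k ≠ 0 →
      ε * (1 / √(1 - (Real.cos θ * Real.sin k) ^ 2) * (Real.cos θ * Real.cos k)) ≠ 0 := by
    intro k hk
    have := Real.sqrt_pos.2 (one_sub_cos_mul_sin_sq_pos hθ₀ hθ₁ k)
    positivity
  simp_rw [fun n => (intervalIntegral.integral_add_adjacent_intervals
    (hi n (-(Real.pi / 2)) (Real.pi / 2)) (hi n (Real.pi / 2) (3 * Real.pi / 2))).symm]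
  rw [← add_zero (0 : ℂ)]
  refine Tendsto.add
    (tendsto_integral_exp_pow_mul (by linarith [Real.pi_pos]) (fun k _ => hf k) ?_ g)
    (tendsto_integral_exp_pow_mul (by linarith [Real.pi_pos]) (fun k _ => hf k) ?_ g)
  · exact fun k hk => hne k (Real.cos_pos_of_mem_Ioo hk).ne'
  · exact fun k hk => hne k (Real.cos_neg_of_pi_div_two_lt_of_lt hk.1 (by linarith [hk.2])).ne

theorem tendsto_coinDensity (hθ₀ : 0 < θ) (hθ₁ : θ < Real.pi / 2) (φ : Fin 2 → ℂ)
    (i j : Fin 2) :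
    Tendsto (fun n => coinDensity (coin θ) φ n i j) atTop
      (𝓝 ((φ i * conj (φ j) + (2 * Real.pi : ℂ)⁻¹ * ∫ k in -(Real.pi / 2)..3 * Real.pi / 2,
        (involution θ k).mulVec φ i * conj ((involution θ k).mulVec φ j)) / 2)) := by
  have hpi : (2 * Real.pi : ℂ) ≠ 0 := by
    exact_mod_cast (by positivity : (2 * Real.pi : ℝ) ≠ 0)
  have hJi := continuous_involution_mulVec hθ₀ hθ₁ φ i
  have hJj := continuous_involution_mulVec hθ₀ hθ₁ φ j
  have hJj' : Continuous fun k => conj ((involution θ k).mulVec φ j) :=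
    Complex.continuous_conj.comp hJj
  have h1 := tendsto_integral_oscillating hθ₀ hθ₁ (ε := 2) (by norm_num)
    (f := fun k => 2 * dispersion θ k - Real.pi)
    (fun k => ((hasDerivAt_dispersion hθ₀ hθ₁ k).const_mul 2).sub_const _)
    (g := fun k => (φ i + (involution θ k).mulVec φ i)
              * (conj (φ j) - conj ((involution θ k).mulVec φ j)) / 4) (by fun_prop)
  have h2 := tendsto_integral_oscillating hθ₀ hθ₁ (ε := -2) (by norm_num)
    (f := fun k => Real.pi - 2 * dispersion θ k)
    (fun k => (((hasDerivAt_dispersion hθ₀ hθ₁ k).const_mul 2).const_sub Real.pi).congr_deriv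
      (by ring))
    (g := fun k => (φ i - (involution θ k).mulVec φ i)
              * (conj (φ j) + conj ((involution θ k).mulVec φ j)) / 4) (by fun_prop)
  have h3 : ∀ n, coinDensity (coin θ) φ n i j
      = (φ i * conj (φ j) + (2 * Real.pi : ℂ)⁻¹ * ∫ k in -(Real.pi / 2)..3 * Real.pi / 2,
          (involution θ k).mulVec φ i * conj ((involution θ k).mulVec φ j)) / 2
        + (2 * Real.pi : ℂ)⁻¹ * ((∫ k in -(Real.pi / 2)..3 * Real.pi / 2,
            Complex.exp ((2 * dispersion θ k - Real.pi : ℝ) * Complex.I) ^ n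
            * ((φ i + (involution θ k).mulVec φ i)
              * (conj (φ j) - conj ((involution θ k).mulVec φ j)) / 4))
          + ∫ k in -(Real.pi / 2)..3 * Real.pi / 2,
            Complex.exp ((Real.pi - 2 * dispersion θ k : ℝ) * Complex.I) ^ n
            * ((φ i - (involution θ k).mulVec φ i)
              * (conj (φ j) + conj ((involution θ k).mulVec φ j)) / 4)) := by
    intro n
    have h := integral_mulVec_mul_conj (coin θ) φ n (-(Real.pi / 2)) i j
    rw [← coinDensity_apply, show -(Real.pi / 2) + 2 * Real.pi = 3 * Real.pi / 2 by ring] at h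
    simp_rw [momentumCoin_pow_mulVec_mul_conj hθ₀ hθ₁] at h
    rw [intervalIntegral.integral_add, intervalIntegral.integral_add,
      intervalIntegral.integral_div, intervalIntegral.integral_add,
      intervalIntegral.integral_const, Complex.real_smul] at h
    · have halg : ∀ p X Y : ℂ, (((3 * Real.pi / 2 - -(Real.pi / 2) : ℝ) : ℂ) * p + X) / 2 + Y
          = 2 * Real.pi * ((p + (2 * Real.pi : ℂ)⁻¹ * X) / 2 + (2 * Real.pi : ℂ)⁻¹ * Y) := by
        intro p X Y
        push_cast
        field_simp
        ring
      rw [← mul_right_inj' hpi, ← h]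
      exact halg _ _ _
    all_goals exact Continuous.intervalIntegrable (by fun_prop) _ _
  simp_rw [h3]
  have := ((h1.add h2).const_mul (2 * Real.pi : ℂ)⁻¹).const_add
    ((φ i * conj (φ j) + (2 * Real.pi : ℂ)⁻¹ * ∫ k in -(Real.pi / 2)..3 * Real.pi / 2,
      (involution θ k).mulVec φ i * conj ((involution θ k).mulVec φ j)) / 2)
  simpa only [add_zero, mul_zero] using this

theorem involution_mulVec_mul_conj (hθ₀ : 0 < θ) (hθ₁ : θ < Real.pi / 2) (k : ℝ)
    (φ : Fin 2 → ℂ) (i j : Fin 2) :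
    (involution θ k).mulVec φ i * conj ((involution θ k).mulVec φ j)
      = (hermitianPart θ k).mulVec φ i * conj ((hermitianPart θ k).mulVec φ j)
        * (1 - ((Real.cos θ : ℂ) * (Real.sin k : ℂ)) ^ 2)⁻¹ := by
  have hD : (Real.cos (dispersion θ k) : ℂ) ^ 2
      = 1 - ((Real.cos θ : ℂ) * (Real.sin k : ℂ)) ^ 2 := by
    exact_mod_cast cos_dispersion_sq hθ₀ hθ₁ k
  rw [← hD]
  simp only [involution, Matrix.smul_mulVec, Pi.smul_apply, smul_eq_mul, map_mul, map_inv₀,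
    Complex.conj_ofReal]
  ring

/-- Once a product of components of the Hermitian part is written as a combination of `1`, `cos²`
and `cos * sin`, its contribution to the limit can be read off. -/
theorem tendsto_coinDensity_of_combination (hθ₀ : 0 < θ) (hθ₁ : θ < Real.pi / 2)
    (φ : Fin 2 → ℂ) (i j : Fin 2) (A B C : ℂ)
    (h : ∀ k, (hermitianPart θ k).mulVec φ i * conj ((hermitianPart θ k).mulVec φ j)
      = A + B * (Real.cos k : ℂ) ^ 2 + C * ((Real.cos k : ℂ) * (Real.sin k : ℂ))) :
    Tendsto (fun n => coinDensity (coin θ) φ n i j) atTop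
      (𝓝 ((φ i * conj (φ j) + (A / Real.sin θ + B * (1 - Real.sin θ) / Real.cos θ ^ 2)) / 2)) := by
  have hpi : (2 * Real.pi : ℂ) ≠ 0 := by
    exact_mod_cast (by positivity : (2 * Real.pi : ℝ) ≠ 0)
  have := tendsto_coinDensity hθ₀ hθ₁ φ i j
  simp_rw [involution_mulVec_mul_conj hθ₀ hθ₁, h] at this
  rwa [integral_combination hθ₀ hθ₁, inv_mul_cancel_left₀ hpi] at this

theorem tendsto_coinDensity_zero_zero (hθ₀ : 0 < θ) (hθ₁ : θ < Real.pi / 2) (α β : ℂ) :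
    Tendsto (fun n => coinDensity (coin θ) ![α, β] n 0 0) atTop
      (𝓝 ((1 - Real.sin θ / 2) * (α * conj α) + Real.sin θ / 2 * (β * conj β)
        + Real.sin θ * (1 - Real.sin θ) / (2 * Real.cos θ) * (α * conj β + conj α * β))) := by
  have hs : (Real.sin θ : ℂ) ≠ 0 := by
    exact_mod_cast (Real.sin_pos_of_pos_of_lt_pi hθ₀ (by linarith [Real.pi_pos])).ne'
  have hc : (Real.cos θ : ℂ) ≠ 0 := by
    exact_mod_cast (Real.cos_pos_of_mem_Ioo ⟨by linarith [Real.pi_pos], hθ₁⟩).ne'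
  convert tendsto_coinDensity_of_combination hθ₀ hθ₁ ![α, β] 0 0
    ((Real.sin θ : ℂ) ^ 2 * (β * conj β))
    ((Real.cos θ : ℂ) ^ 2 * (α * conj α)
      + Real.cos θ * Real.sin θ * (α * conj β + conj α * β))
    (Complex.I * Real.cos θ * Real.sin θ * (conj α * β - α * conj β)) ?_ using 2
  · simp only [Matrix.cons_val_zero]
    generalize (Real.sin θ : ℂ) = s at *
    generalize (Real.cos θ : ℂ) = c at *
    field_simp
    ring
  · intro k
    have hk : (Real.sin k : ℂ) ^ 2 = 1 - (Real.cos k : ℂ) ^ 2 := by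
      exact_mod_cast Real.sin_sq k
    have hI := Complex.I_sq
    simp only [hermitianPart, Matrix.mulVec, dotProduct, Fin.sum_univ_two, Matrix.of_apply,
      Matrix.cons_val_zero, Matrix.cons_val_one, map_add, map_mul, Complex.conj_ofReal,
      Complex.conj_I]
    generalize (Real.sin θ : ℂ) = s at *
    generalize (Real.cos θ : ℂ) = c at *
    generalize (Real.sin k : ℂ) = y at *
    generalize (Real.cos k : ℂ) = x at *
    linear_combination s ^ 2 * β * conj β * hk - s ^ 2 * β * conj β * y ^ 2 * hI

theorem tendsto_coinDensity_one_one (hθ₀ : 0 < θ) (hθ₁ : θ < Real.pi / 2) (α β : ℂ) :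
    Tendsto (fun n => coinDensity (coin θ) ![α, β] n 1 1) atTop
      (𝓝 (Real.sin θ / 2 * (α * conj α) + (1 - Real.sin θ / 2) * (β * conj β)
        - Real.sin θ * (1 - Real.sin θ) / (2 * Real.cos θ) * (α * conj β + conj α * β))) := by
  have hs : (Real.sin θ : ℂ) ≠ 0 := by
    exact_mod_cast (Real.sin_pos_of_pos_of_lt_pi hθ₀ (by linarith [Real.pi_pos])).ne'
  have hc : (Real.cos θ : ℂ) ≠ 0 := by
    exact_mod_cast (Real.cos_pos_of_mem_Ioo ⟨by linarith [Real.pi_pos], hθ₁⟩).ne'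
  convert tendsto_coinDensity_of_combination hθ₀ hθ₁ ![α, β] 1 1
    ((Real.sin θ : ℂ) ^ 2 * (α * conj α))
    ((Real.cos θ : ℂ) ^ 2 * (β * conj β)
      - Real.cos θ * Real.sin θ * (α * conj β + conj α * β))
    (Complex.I * Real.cos θ * Real.sin θ * (α * conj β - conj α * β)) ?_ using 2
  · simp only [Matrix.cons_val_one, Matrix.cons_val_zero]
    generalize (Real.sin θ : ℂ) = s at *
    generalize (Real.cos θ : ℂ) = c at *
    field_simp
    ring
  · intro k
    have hk : (Real.sin k : ℂ) ^ 2 = 1 - (Real.cos k : ℂ) ^ 2 := by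
      exact_mod_cast Real.sin_sq k
    have hI := Complex.I_sq
    simp only [hermitianPart, Matrix.mulVec, dotProduct, Fin.sum_univ_two, Matrix.of_apply,
      Matrix.cons_val_zero, Matrix.cons_val_one, map_add, map_sub, map_neg, map_mul,
      Complex.conj_ofReal, Complex.conj_I]
    generalize (Real.sin θ : ℂ) = s at *
    generalize (Real.cos θ : ℂ) = c at *
    generalize (Real.sin k : ℂ) = y at *
    generalize (Real.cos k : ℂ) = x at *
    linear_combination s ^ 2 * α * conj α * hk - s ^ 2 * α * conj α * y ^ 2 * hI

theorem tendsto_coinDensity_zero_one (hθ₀ : 0 < θ) (hθ₁ : θ < Real.pi / 2) (α β : ℂ) :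
    Tendsto (fun n => coinDensity (coin θ) ![α, β] n 0 1) atTop
      (𝓝 (Real.sin θ * (1 - Real.sin θ) / (2 * Real.cos θ) * (α * conj α - β * conj β
        + (Real.sin θ * (α * conj β + conj α * β) + α * conj β - conj α * β) / Real.cos θ))) := by
  have hs : (Real.sin θ : ℂ) ≠ 0 := by
    exact_mod_cast (Real.sin_pos_of_pos_of_lt_pi hθ₀ (by linarith [Real.pi_pos])).ne'
  have hc : (Real.cos θ : ℂ) ≠ 0 := by
    exact_mod_cast (Real.cos_pos_of_mem_Ioo ⟨by linarith [Real.pi_pos], hθ₁⟩).ne'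
  have hθ : (Real.cos θ : ℂ) ^ 2 = 1 - (Real.sin θ : ℂ) ^ 2 := by
    exact_mod_cast Real.cos_sq' θ
  convert tendsto_coinDensity_of_combination hθ₀ hθ₁ ![α, β] 0 1
    (-(Real.sin θ : ℂ) ^ 2 * (conj α * β))
    (-(Real.cos θ : ℂ) ^ 2 * (α * conj β) + 2 * (Real.sin θ : ℂ) ^ 2 * (conj α * β)
      + Real.cos θ * Real.sin θ * (α * conj α - β * conj β))
    (Complex.I * (Real.cos θ * Real.sin θ * (α * conj α - β * conj β)
      + 2 * (Real.sin θ : ℂ) ^ 2 * (conj α * β))) ?_ using 2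
  · simp only [Matrix.cons_val_one, Matrix.cons_val_zero]
    generalize (Real.sin θ : ℂ) = s at *
    generalize (Real.cos θ : ℂ) = c at *
    field_simp
    linear_combination (-(s * α * conj β) + s * (conj α * β)) * hθ
  · intro k
    have hk : (Real.sin k : ℂ) ^ 2 = 1 - (Real.cos k : ℂ) ^ 2 := by
      exact_mod_cast Real.sin_sq k
    have hI := Complex.I_sq
    simp only [hermitianPart, Matrix.mulVec, dotProduct, Fin.sum_univ_two, Matrix.of_apply,
      Matrix.cons_val_zero, Matrix.cons_val_one, map_add, map_sub, map_neg, map_mul,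
      Complex.conj_ofReal, Complex.conj_I]
    generalize (Real.sin θ : ℂ) = s at *
    generalize (Real.cos θ : ℂ) = c at *
    generalize (Real.sin k : ℂ) = y at *
    generalize (Real.cos k : ℂ) = x at *
    linear_combination -s ^ 2 * β * conj α * hk + s ^ 2 * β * conj α * y ^ 2 * hI

end Spectral

/-! ### The von Neumann entropy of a qubit -/

theorem vonNeumannEntropy_eq_sum_eigenvalues {ρ : Matrix (Fin 2) (Fin 2) ℂ}
    (hρ : ρ.IsHermitian) :
    vonNeumannEntropy ρ = -(hρ.eigenvalues 0 * Real.logb 2 (hρ.eigenvalues 0)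
      + hρ.eigenvalues 1 * Real.logb 2 (hρ.eigenvalues 1)) := by
  have h : ρ * cfc (Real.logb 2) ρ = Unitary.conjStarAlgAut ℂ (Matrix (Fin 2) (Fin 2) ℂ)
      hρ.eigenvectorUnitary (Matrix.diagonal fun i =>
        ((hρ.eigenvalues i * Real.logb 2 (hρ.eigenvalues i) : ℝ) : ℂ)) := by
    rw [hρ.cfc_eq, Matrix.IsHermitian.cfc]
    conv_lhs => enter [1]; rw [hρ.spectral_theorem]
    rw [← map_mul, Matrix.diagonal_mul_diagonal]
    congr 2
    ext i
    simp
  rw [vonNeumannEntropy, h, Unitary.conjStarAlgAut_apply, Matrix.trace_mul_cycle,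
    Unitary.coe_star_mul_self, one_mul, Matrix.trace_diagonal, Fin.sum_univ_two,
    ← Complex.ofReal_add, Complex.ofReal_re]

/-- The entropy of a `2 × 2` Hermitian matrix with trace `T` and determinant `d`: its eigenvalues
are the roots of `x ^ 2 - T * x + d`. -/
theorem vonNeumannEntropy_eq {ρ : Matrix (Fin 2) (Fin 2) ℂ} (hρ : ρ.IsHermitian) {T d : ℝ}
    (hT : ρ.trace = T) (hd : ρ.det = d) :
    vonNeumannEntropy ρ
      = -((T + √(T ^ 2 - 4 * d)) / 2 * Real.logb 2 ((T + √(T ^ 2 - 4 * d)) / 2)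
        + (T - √(T ^ 2 - 4 * d)) / 2 * Real.logb 2 ((T - √(T ^ 2 - 4 * d)) / 2)) := by
  rw [vonNeumannEntropy_eq_sum_eigenvalues hρ]
  rw [hρ.trace_eq_sum_eigenvalues, Fin.sum_univ_two] at hT
  rw [hρ.det_eq_prod_eigenvalues, Fin.prod_univ_two] at hd
  generalize hρ.eigenvalues 0 = x at *
  generalize hρ.eigenvalues 1 = y at *
  have hT' : x + y = T := Complex.ofReal_injective (by simpa using hT)
  have hd' : x * y = d := Complex.ofReal_injective (by simpa using hd)
  have hs : √(T ^ 2 - 4 * d) = |x - y| := by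
    rw [← Real.sqrt_sq_eq_abs, ← hT', ← hd']
    congr 1
    ring
  rw [hs, ← hT']
  rcases abs_cases (x - y) with ⟨h, _⟩ | ⟨h, _⟩
  · rw [h, show (x + y + (x - y)) / 2 = x by ring, show (x + y - (x - y)) / 2 = y by ring]
  · rw [h, show (x + y + -(x - y)) / 2 = y by ring, show (x + y - -(x - y)) / 2 = x by ring,
      add_comm]

theorem continuous_mul_logb : Continuous fun x : ℝ => x * Real.logb 2 x := by
  have : (fun x : ℝ => x * Real.logb 2 x) = fun x => x * Real.log x / Real.log 2 := by
    ext x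
    rw [Real.logb, mul_div_assoc]
  rw [this]
  exact Real.continuous_mul_log.div_const _

theorem tendsto_vonNeumannEntropy {ρ : ℕ → Matrix (Fin 2) (Fin 2) ℂ}
    (hρ : ∀ n, (ρ n).IsHermitian) {T d : ℕ → ℝ} {d' : ℝ} (hT : ∀ n, (ρ n).trace = T n)
    (hd : ∀ n, (ρ n).det = d n) (hT' : Tendsto T atTop (𝓝 1)) (hd' : Tendsto d atTop (𝓝 d')) :
    Tendsto (fun n => vonNeumannEntropy (ρ n)) atTop
      (𝓝 (-((1 + √(1 - 4 * d')) / 2 * Real.logb 2 ((1 + √(1 - 4 * d')) / 2)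
        + (1 - √(1 - 4 * d')) / 2 * Real.logb 2 ((1 - √(1 - 4 * d')) / 2)))) := by
  simp_rw [fun n => vonNeumannEntropy_eq (hρ n) (hT n) (hd n)]
  have hs : Tendsto (fun n => √(T n ^ 2 - 4 * d n)) atTop (𝓝 √(1 - 4 * d')) := by
    have := ((hT'.pow 2).sub (hd'.const_mul 4)).sqrt
    rwa [one_pow] at this
  exact (((continuous_mul_logb.tendsto _).comp ((hT'.add hs).div_const 2)).add
    ((continuous_mul_logb.tendsto _).comp ((hT'.sub hs).div_const 2))).neg

/-! ### Trace and determinant of the coin density -/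

theorem isHermitian_coinDensity (U : Matrix (Fin 2) (Fin 2) ℂ) (φ : Fin 2 → ℂ) (n : ℕ) :
    (coinDensity U φ n).IsHermitian := by
  ext i j
  rw [Matrix.conjTranspose_apply, coinDensity_apply, coinDensity_apply, star_sum]
  refine Finset.sum_congr rfl fun x _ => ?_
  simp [mul_comm]

theorem trace_coinDensity (U : Matrix (Fin 2) (Fin 2) ℂ) (φ : Fin 2 → ℂ) (n : ℕ) :
    (coinDensity U φ n).trace
      = ((normSqAmplitude U φ n 0 + normSqAmplitude U φ n 1 : ℝ) : ℂ) := by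
  rw [Matrix.trace_fin_two, ← normSqAmplitude_eq, ← normSqAmplitude_eq, Complex.ofReal_add]

theorem det_coinDensity (U : Matrix (Fin 2) (Fin 2) ℂ) (φ : Fin 2 → ℂ) (n : ℕ) :
    (coinDensity U φ n).det
      = ((normSqAmplitude U φ n 0 * normSqAmplitude U φ n 1 - ‖innerRL U φ n‖ ^ 2 : ℝ) : ℂ) := by
  have h : coinDensity U φ n 1 0 = conj (coinDensity U φ n 0 1) :=
    ((isHermitian_coinDensity U φ n).apply 1 0).symm
  rw [Matrix.det_fin_two, h, innerRL_eq, ← normSqAmplitude_eq, ← normSqAmplitude_eq,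
    Complex.mul_conj']
  push_cast
  rfl

end QuantumWalk

theorem corollary1 (θ : ℝ) (hθ₀ : 0 < θ) (hθ₁ : θ < Real.pi / 2)
    (α β : ℂ) (hαβ : ‖α‖ ^ 2 + ‖β‖ ^ 2 = 1) :
    ∃ (normSqL normSqR : ℝ) (innerLim : ℂ) (Δ rPlus rMinus : ℝ),
      normSqL = (1 - Real.sin θ / 2) * ‖α‖ ^ 2 + Real.sin θ / 2 * ‖β‖ ^ 2
        + Real.sin θ * (1 - Real.sin θ) / (2 * Real.cos θ) * (α * conj β + conj α * β).re ∧
      normSqR = Real.sin θ / 2 * ‖α‖ ^ 2 + (1 - Real.sin θ / 2) * ‖β‖ ^ 2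
        - Real.sin θ * (1 - Real.sin θ) / (2 * Real.cos θ) * (α * conj β + conj α * β).re ∧
      innerLim = ((Real.sin θ * (1 - Real.sin θ) / (2 * Real.cos θ) : ℝ) : ℂ)
        * ((‖α‖ : ℂ) ^ 2 - (‖β‖ : ℂ) ^ 2
          + ((Real.sin θ : ℂ) * (α * conj β + conj α * β) + α * conj β - conj α * β)
            / (Real.cos θ : ℂ)) ∧
      Δ = normSqL * normSqR - ‖innerLim‖ ^ 2 ∧
      rPlus = (1 + √(1 - 4 * Δ)) / 2 ∧
      rMinus = (1 - √(1 - 4 * Δ)) / 2 ∧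
      Tendsto (fun n : ℕ => QuantumWalk.normSqAmplitude (QuantumWalk.coin θ) ![α, β] n 0)
        atTop (𝓝 normSqL) ∧
      Tendsto (fun n : ℕ => QuantumWalk.normSqAmplitude (QuantumWalk.coin θ) ![α, β] n 1)
        atTop (𝓝 normSqR) ∧
      Tendsto (fun n : ℕ => QuantumWalk.innerRL (QuantumWalk.coin θ) ![α, β] n)
        atTop (𝓝 innerLim) ∧
      Tendsto (fun n : ℕ => QuantumWalk.entanglementEntropy (QuantumWalk.coin θ) ![α, β] n)
        atTop (𝓝 (-(rPlus * Real.logb 2 rPlus + rMinus * Real.logb 2 rMinus))) := by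
  obtain ⟨r, hr⟩ : ∃ r : ℝ, α * conj β + conj α * β = (r : ℂ) :=
    Complex.conj_eq_iff_real.1 (by simp [add_comm])
  have h00 : Tendsto (fun n => QuantumWalk.normSqAmplitude (QuantumWalk.coin θ) ![α, β] n 0)
      atTop (𝓝 ((1 - Real.sin θ / 2) * ‖α‖ ^ 2 + Real.sin θ / 2 * ‖β‖ ^ 2
        + Real.sin θ * (1 - Real.sin θ) / (2 * Real.cos θ)
          * (α * conj β + conj α * β).re)) := by
    have h := (Complex.continuous_re.tendsto _).comp
      (QuantumWalk.tendsto_coinDensity_zero_zero hθ₀ hθ₁ α β)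
    simp only [← QuantumWalk.normSqAmplitude_eq, Function.comp_def, Complex.ofReal_re,
      Complex.mul_conj'] at h
    rw [hr] at h ⊢
    exact_mod_cast h
  have h11 : Tendsto (fun n => QuantumWalk.normSqAmplitude (QuantumWalk.coin θ) ![α, β] n 1)
      atTop (𝓝 (Real.sin θ / 2 * ‖α‖ ^ 2 + (1 - Real.sin θ / 2) * ‖β‖ ^ 2
        - Real.sin θ * (1 - Real.sin θ) / (2 * Real.cos θ)
          * (α * conj β + conj α * β).re)) := by
    have h := (Complex.continuous_re.tendsto _).comp
      (QuantumWalk.tendsto_coinDensity_one_one hθ₀ hθ₁ α β)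
    simp only [← QuantumWalk.normSqAmplitude_eq, Function.comp_def, Complex.ofReal_re,
      Complex.mul_conj'] at h
    rw [hr] at h ⊢
    exact_mod_cast h
  have h01 := QuantumWalk.tendsto_coinDensity_zero_one hθ₀ hθ₁ α β
  simp only [← QuantumWalk.innerRL_eq, Complex.mul_conj'] at h01
  refine ⟨_, _, _, _, _, _, rfl, rfl, rfl, rfl, rfl, rfl, h00, h11, ?_, ?_⟩
  · convert h01 using 2
    push_cast
    rfl
  · refine QuantumWalk.tendsto_vonNeumannEntropy
      (fun n => QuantumWalk.isHermitian_coinDensity _ _ n)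
      (fun n => QuantumWalk.trace_coinDensity _ _ n) (fun n => QuantumWalk.det_coinDensity _ _ n)
      ?_ ?_
    · convert h00.add h11 using 2
      linear_combination -hαβ
    · convert (h00.mul h11).sub (h01.norm.pow 2) using 2
      push_cast
      rfl
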